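/- **Corollary 3.6.** Let $N\ge 2$ be an integer, let $\chi$ be a primitive Dirichlet character modulo $N$ (extended by $0$ to residues not coprime to $N$), and let $n\ge 1$ be an integer. Put $$L_{\mathbb{Z}/N\mathbb{Z}}(s,\chi)=\sum_{m=1}^{N-1}\frac{\chi(m)}{\sin^{2s}(m\pi/N)},\qquad \widetilde L_{\mathbb{Z}/N\mathbb{Z}}(s,\chi)=\sum_{m=1}^{N-1}\frac{\chi(m)\cot(m\pi/N)}{\sin^{2s}(m\pi/N)},$$ let $c_{n,i}$ be the coefficient of $x^{-2i}$ in the Laurent expansion of $(\sin x)^{-2n}$ at $x=0$, let $\mathbf{B}_k(x)$ be the $k$-th Bernoulli polynomial, and let $G(\bar\chi)=\sum_{a=1}^{N}\bar\chi(a)e^{2\pi \sqrt{-1}\,a/N}$ be the Gauss sum of $\bar\chi$. (i) If $\chi$ is even, i.e. $\chi(-1)=1$, then $$L_{\mathbb{Z}/N\mathbb{Z}}(n,\chi)=\sum_{j=1}^{N}\frac{\bar\chi(j)}{G(\bar\chi)}\sum_{i=1}^{n}\frac{(-1)^{i-1}2^{2i}\,\mathbf{B}_{2i}(j/N)}{(2i)!}\,c_{n,i}\,N^{2i}.$$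 (ii) If $\chi$ is odd, i.e. $\chi(-1)=-1$, then $$\widetilde L_{\mathbb{Z}/N\mathbb{Z}}(n,\chi)=-\frac1n\sum_{j=1}^{N}\frac{\bar\chi(j)}{G(\bar\chi)}\sum_{i=1}^{n}\frac{(2\sqrt{-1})^{2i+1}\,\mathbf{B}_{2i+1}(j/N)}{(2i+1)!}\,i\,c_{n,i}\,N^{2i+1}.$$ -/

import Mathlib

open scoped BigOperators

/-- The Dirichlet `L`-function of the cycle graph on `ℤ/Nℤ`:
`L_{ℤ/Nℤ}(s, χ) = ∑_{m=1}^{N-1} χ(m) / sin(mπ/N)^{2s}`. -/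
noncomputable def cycleGraphL (N : ℕ) (s : ℂ) (χ : DirichletCharacter ℂ N) : ℂ :=
  ∑ m ∈ Finset.Icc 1 (N - 1),
    χ (m : ZMod N) / ((Real.sin (m * Real.pi / N) : ℝ) : ℂ) ^ (2 * s)

/-- The cotangent-twisted variant:
`L̃_{ℤ/Nℤ}(s, χ) = ∑_{m=1}^{N-1} χ(m) cot(mπ/N) / sin(mπ/N)^{2s}`. -/
noncomputable def cycleGraphLTilde (N : ℕ) (s : ℂ) (χ : DirichletCharacter ℂ N) : ℂ :=
  ∑ m ∈ Finset.Icc 1 (N - 1),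
    χ (m : ZMod N) * ((Real.cot (m * Real.pi / N) : ℝ) : ℂ) /
      ((Real.sin (m * Real.pi / N) : ℝ) : ℂ) ^ (2 * s)

/-- The Laurent expansion of `(sin x)^{-2n}` at `x = 0`: the inverse, in the field of Laurent
series, of the `2n`-th power of the Taylor series of `sin` at `0`. -/
noncomputable def sinInvPowLaurent (n : ℕ) : LaurentSeries ℂ :=
  (((PowerSeries.sin ℂ : PowerSeries ℂ) : LaurentSeries ℂ) ^ (2 * n))⁻¹

/-- `c_{n,i}`, the coefficient of `x^{-2i}` in the Laurent expansion of `(sin x)^{-2n}`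
at `x = 0`. -/
noncomputable def sinLaurentCoeff (n i : ℕ) : ℂ :=
  (sinInvPowLaurent n).coeff (-(2 * (i : ℤ)))

/-- The Gauss sum `G(χ) = ∑_{1 ≤ a ≤ N} χ(a) e^{2πia/N}`. -/
noncomputable def dirichletGaussSum (N : ℕ) (χ : DirichletCharacter ℂ N) : ℂ :=
  ∑ a ∈ Finset.Icc 1 N,
    χ (a : ZMod N) * Complex.exp (2 * Real.pi * Complex.I * a / N)

/-! Both formulas come from a partial fraction expansion. With `c_{n,i}` as above and `S_k(z) = ∑_{m
∈ ℤ} (z+m)^{-k}`, one has `sin(πz)^{-2n} = ∑_i c_{n,i} π^{-2i} S_{2i}(z)`; differentiating once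
gives the cotangent version with `S_{2i+1}`. The expansion is proved on the upper half plane by
induction on `n`: since `(sin^{-2n})'' = 2n(2n+1) sin^{-2n-2} - 4n² sin^{-2n}`, the functions obey
the same recursion as the coefficients (`sinLaurentCoeff_succ_succ`). It passes to the real points
`m/N` by a limit.

Summing `χ(m) S_k(m/N)` over residues reassembles `N^k ∑_l χ(l) l^{-k}` (`sum_mul_intShiftSum_div`).
Primitivity writes `χ(l)` as a combination of the characters `e^{2πijl/N}`, and the Fourier series
of the Bernoulli polynomials evaluates the sum (`hasSum_primitive_div_int_pow`). -/

/-! ### Laurent coefficients of `sin^{-2n}` and their recursion. -/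

open PowerSeries in
/-- The power series `sin X / X`. -/
noncomputable def sincSeries : PowerSeries ℂ :=
  PowerSeries.mk fun n => coeff (n + 1) (PowerSeries.sin ℂ)

open PowerSeries in
lemma X_mul_sincSeries : (X : PowerSeries ℂ) * sincSeries = PowerSeries.sin ℂ := by
  ext n
  cases n with
  | zero => simp [PowerSeries.sin]
  | succ n => simp [sincSeries, coeff_succ_X_mul]

open PowerSeries in
lemma constantCoeff_sincSeries : constantCoeff sincSeries = 1 := by
  rw [← coeff_zero_eq_constantCoeff_apply]
  simp [sincSeries, PowerSeries.sin]

open PowerSeries in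
lemma sincSeries_mul_inv : sincSeries * sincSeries⁻¹ = 1 :=
  PowerSeries.mul_inv_cancel _ (by simp [constantCoeff_sincSeries])

open PowerSeries in
lemma derivative_sin_series : d⁄dX ℂ (PowerSeries.sin ℂ) = PowerSeries.cos ℂ := by
  ext n
  rw [coeff_derivative]
  have h : ((n : ℂ) + 1) ≠ 0 := by exact_mod_cast n.succ_ne_zero
  have h' : (n.factorial : ℂ) ≠ 0 := by exact_mod_cast n.factorial_ne_zero
  by_cases hn : Even n
  · have h2 : (n + 1) / 2 = n / 2 := by obtain ⟨k, rfl⟩ := hn; omega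
    simp [PowerSeries.sin, PowerSeries.cos, hn, Nat.even_add_one, h2, Nat.factorial_succ]
    field_simp
  · simp [PowerSeries.sin, PowerSeries.cos, hn, Nat.even_add_one]

open PowerSeries in
lemma derivative_cos_series : d⁄dX ℂ (PowerSeries.cos ℂ) = -PowerSeries.sin ℂ := by
  ext n
  rw [coeff_derivative]
  have h : ((n : ℂ) + 1) ≠ 0 := by exact_mod_cast n.succ_ne_zero
  have h' : (n.factorial : ℂ) ≠ 0 := by exact_mod_cast n.factorial_ne_zero
  by_cases hn : Even n
  · simp [PowerSeries.sin, PowerSeries.cos, hn, Nat.even_add_one]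
  · have h2 : (n + 1) / 2 = n / 2 + 1 := by
      obtain ⟨k, rfl⟩ := Nat.not_even_iff_odd.mp hn; omega
    simp [PowerSeries.sin, PowerSeries.cos, hn, Nat.even_add_one, h2, Nat.factorial_succ, pow_succ]
    field_simp

open PowerSeries in
lemma sin_series_sq_add_cos_series_sq :
    PowerSeries.sin ℂ ^ 2 + PowerSeries.cos ℂ ^ 2 = 1 := by
  apply PowerSeries.derivative.ext
  · simp only [map_add, derivative_pow, derivative_sin_series, derivative_cos_series,
      derivative_one]
    push_cast
    ring
  · have hs : constantCoeff (PowerSeries.sin ℂ) = 0 := by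
      rw [← coeff_zero_eq_constantCoeff_apply]; simp [PowerSeries.sin]
    have hc : constantCoeff (PowerSeries.cos ℂ) = 1 := by
      rw [← coeff_zero_eq_constantCoeff_apply]; simp [PowerSeries.cos]
    simp [hs, hc]

-- The equation `f'' = 2n(2n+1) sin^{-2n-2} - 4n² f` for `f = sin^{-2n} = X^{-2n} sinc^{-2n}`,
-- multiplied by `X^{2n+2}` so that no Laurent series is differentiated.
open PowerSeries in
lemma sincSeries_inv_pow_ode (n : ℕ) (hn : 1 ≤ n) :
    X ^ 2 * d⁄dX ℂ (d⁄dX ℂ (sincSeries⁻¹ ^ (2 * n)))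
      - (4 * n : PowerSeries ℂ) * (X * d⁄dX ℂ (sincSeries⁻¹ ^ (2 * n)))
      + (2 * n * (2 * n + 1) : PowerSeries ℂ) * sincSeries⁻¹ ^ (2 * n)
    = (2 * n * (2 * n + 1) : PowerSeries ℂ) * sincSeries⁻¹ ^ (2 * (n + 1))
      - (4 * n ^ 2 : PowerSeries ℂ) * (X ^ 2 * sincSeries⁻¹ ^ (2 * n)) := by
  have hX := X_mul_sincSeries
  have huv := sincSeries_mul_inv
  have h1 := derivative_sin_series
  have h2 := derivative_cos_series
  have h3 := sin_series_sq_add_cos_series_sq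
  rw [← h1, ← hX] at h2 h3
  have hinv := derivative_inv' sincSeries
  generalize hv : sincSeries⁻¹ = v at *
  generalize hu : sincSeries = u at *
  obtain ⟨m, rfl⟩ : ∃ m, n = m + 1 := ⟨n - 1, by omega⟩
  simp only [Derivation.leibniz, derivative_X, derivative_one, map_add, smul_eq_mul] at h2 h3
  have e1 : d⁄dX ℂ (v ^ (2 * (m + 1))) = -(2 * (m + 1) : PowerSeries ℂ) *
      (v ^ (2 * m + 3) * d⁄dX ℂ u) := by
    rw [derivative_pow, hinv, show 2 * (m + 1) - 1 = 2 * m + 1 by omega]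
    push_cast
    ring
  have e2 : d⁄dX ℂ (d⁄dX ℂ (v ^ (2 * (m + 1)))) =
      (2 * (m + 1) * (2 * m + 3) : PowerSeries ℂ) * (v ^ (2 * m + 4) * (d⁄dX ℂ u) ^ 2)
      - (2 * (m + 1) : PowerSeries ℂ) * (v ^ (2 * m + 3) * d⁄dX ℂ (d⁄dX ℂ u)) := by
    have hc : d⁄dX ℂ (-(2 * (m + 1) : PowerSeries ℂ)) = 0 := by
      have : (-(2 * (m + 1) : PowerSeries ℂ)) = C (-(2 * ((m : ℂ) + 1))) := by
        simp [show (C (2 : ℂ)) = 2 from map_ofNat C 2]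
      rw [this, derivative_C]
    rw [e1, Derivation.leibniz, hc, Derivation.leibniz, derivative_pow, hinv,
      show 2 * m + 3 - 1 = 2 * m + 2 by omega]
    simp only [smul_eq_mul]
    push_cast
    ring
  rw [e2, e1]
  generalize d⁄dX ℂ (d⁄dX ℂ u) = u'' at *
  generalize d⁄dX ℂ u = u' at *
  -- Inserting `u * v = 1` brings every term to the power `v ^ (2m+4)`; what remains follows from
  -- `sin² + cos² = 1` and `sin'' = -sin`, both expressed through `X * u`.
  have p2 : v ^ (2 * (m + 1)) = v ^ (2 * m + 4) * u ^ 2 := by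
    linear_combination (-(v ^ (2 * m + 2)) * (u * v + 1)) * huv
  have p3 : v ^ (2 * m + 3) = v ^ (2 * m + 4) * u := by
    linear_combination (-(v ^ (2 * m + 3))) * huv
  have p4 : v ^ (2 * (m + 1 + 1)) = v ^ (2 * m + 4) := by ring
  rw [p2, p3, p4]
  push_cast
  linear_combination (v ^ (2 * m + 4) * (2 * (m + 1) * (2 * m + 3))) * h3
    - (v ^ (2 * m + 4) * (2 * (m + 1)) * u * X) * h2

lemma sinInvPowLaurent_eq (n : ℕ) : sinInvPowLaurent n =
    HahnSeries.single (-(2 * n : ℤ)) 1 *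
      ((sincSeries⁻¹ ^ (2 * n) : PowerSeries ℂ) : LaurentSeries ℂ) := by
  rw [sinInvPowLaurent]
  apply inv_eq_of_mul_eq_one_right
  rw [← X_mul_sincSeries, PowerSeries.coe_mul, PowerSeries.coe_X, mul_pow, HahnSeries.single_pow,
    mul_mul_mul_comm, HahnSeries.single_mul_single, ← map_pow, ← PowerSeries.coe_mul, ← mul_pow,
    sincSeries_mul_inv]
  simp

lemma sinLaurentCoeff_eq {n i : ℕ} (h : i ≤ n) :
    sinLaurentCoeff n i = PowerSeries.coeff (2 * n - 2 * i) (sincSeries⁻¹ ^ (2 * n)) := by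
  rw [sinLaurentCoeff, sinInvPowLaurent_eq,
    show -(2 * (i : ℤ)) = ((2 * n - 2 * i : ℕ) : ℤ) + -(2 * n : ℤ) by omega,
    HahnSeries.coeff_single_mul_add, one_mul, LaurentSeries.coeff_coe_powerSeries]

lemma sinLaurentCoeff_eq_zero {n i : ℕ} (h : n < i) : sinLaurentCoeff n i = 0 := by
  rw [sinLaurentCoeff, sinInvPowLaurent_eq,
    show -(2 * (i : ℤ)) = (2 * n - 2 * i : ℤ) + -(2 * n : ℤ) by ring,
    HahnSeries.coeff_single_mul_add, one_mul, PowerSeries.coeff_coe, if_pos (by omega)]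

lemma sinLaurentCoeff_self (n : ℕ) : sinLaurentCoeff n n = 1 := by
  rw [sinLaurentCoeff_eq le_rfl]
  simp [constantCoeff_sincSeries]

open PowerSeries in
lemma sinLaurentCoeff_succ_succ {n : ℕ} (hn : 1 ≤ n) (i : ℕ) :
    (2 * n * (2 * n + 1) : ℂ) * sinLaurentCoeff (n + 1) (i + 1) =
      (2 * i * (2 * i + 1) : ℂ) * sinLaurentCoeff n i +
        (4 * n ^ 2 : ℂ) * sinLaurentCoeff n (i + 1) := by
  -- The degree compared below is `2(n-i) = 2d + 2`, so `i ≥ n` is treated apart.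
  rcases lt_or_ge n i with h | h
  · rw [sinLaurentCoeff_eq_zero h, sinLaurentCoeff_eq_zero (by omega : n < i + 1),
      sinLaurentCoeff_eq_zero (by omega : n + 1 < i + 1)]
    simp
  rcases eq_or_lt_of_le h with rfl | h
  · rw [sinLaurentCoeff_self, sinLaurentCoeff_self, sinLaurentCoeff_eq_zero (by omega)]
    ring
  obtain ⟨d, rfl⟩ : ∃ d, n = i + 1 + d := ⟨n - (i + 1), by omega⟩
  rw [sinLaurentCoeff_eq (by omega), sinLaurentCoeff_eq (by omega), sinLaurentCoeff_eq (by omega)]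
  have h := congrArg (coeff (2 * d + 2)) (sincSeries_inv_pow_ode (i + 1 + d) hn)
  have c2 : C (2 : ℂ) = 2 := map_ofNat C 2
  have c4 : C (4 : ℂ) = 4 := map_ofNat C 4
  have e1 : (4 * (i + 1 + d : ℕ) : PowerSeries ℂ) = C (4 * ((i + 1 + d : ℕ) : ℂ)) := by
    simp [c4]
  have e2 : (2 * (i + 1 + d : ℕ) * (2 * (i + 1 + d : ℕ) + 1) : PowerSeries ℂ) =
      C (2 * ((i + 1 + d : ℕ) : ℂ) * (2 * ((i + 1 + d : ℕ) : ℂ) + 1)) := by simp [c2]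
  have e3 : (4 * (i + 1 + d : ℕ) ^ 2 : PowerSeries ℂ) = C (4 * ((i + 1 + d : ℕ) : ℂ) ^ 2) := by
    simp [c4]
  rw [e1, e2, e3] at h
  rw [show 2 * (i + 1 + d + 1) - 2 * (i + 1) = 2 * d + 2 by omega,
    show 2 * (i + 1 + d) - 2 * i = 2 * d + 2 by omega,
    show 2 * (i + 1 + d) - 2 * (i + 1) = 2 * d by omega]
  simp only [map_add, map_sub, coeff_C_mul, coeff_derivative,
    show 2 * d + 2 = (2 * d + 1) + 1 by rfl, coeff_succ_X_mul] at h
  have h' : coeff (2 * d + 1 + 1) (X ^ 2 * d⁄dX ℂ (d⁄dX ℂ (sincSeries⁻¹ ^ (2 * (i + 1 + d))))) =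
      coeff (2 * d) (d⁄dX ℂ (d⁄dX ℂ (sincSeries⁻¹ ^ (2 * (i + 1 + d))))) :=
    coeff_X_pow_mul _ 2 (2 * d)
  have h'' : coeff (2 * d + 1 + 1) (X ^ 2 * (sincSeries⁻¹ ^ (2 * (i + 1 + d)))) =
      coeff (2 * d) (sincSeries⁻¹ ^ (2 * (i + 1 + d))) :=
    coeff_X_pow_mul _ 2 (2 * d)
  rw [h', h''] at h
  simp only [coeff_derivative] at h
  push_cast at h ⊢
  linear_combination -h

/-! ### Partial fractions of `sin^{-2n}` on the upper half plane. -/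

/-- The sum `∑ 1 / (z + m) ^ k` over all integers `m`. -/
noncomputable def intShiftSum (k : ℕ) (z : ℂ) : ℂ := ∑' m : ℤ, 1 / (z + m) ^ k

open UpperHalfPlane Complex in
lemma contDiffOn_pi_mul_cot_pi (k : ℕ) :
    ContDiffOn ℂ k (fun x : ℂ ↦ Real.pi * cot (Real.pi * x)) upperHalfPlaneSet := fun z hz ↦
  ContDiffWithinAt.mul (by fun_prop)
    (cot_pi_mul_contDiffWithinAt k (coe_mem_integerComplement ⟨z, hz⟩))

open UpperHalfPlane Complex in
lemma hasDerivAt_iteratedDerivWithin_cot (k : ℕ) {z : ℂ} (hz : z ∈ upperHalfPlaneSet) :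
    HasDerivAt (iteratedDerivWithin k (fun x : ℂ ↦ Real.pi * cot (Real.pi * x)) upperHalfPlaneSet)
      (iteratedDerivWithin (k + 1) (fun x : ℂ ↦ Real.pi * cot (Real.pi * x)) upperHalfPlaneSet z)
      z := by
  rw [iteratedDerivWithin_succ]
  have hd := (contDiffOn_pi_mul_cot_pi (k + 1)).differentiableOn_iteratedDerivWithin (m := k)
    (by exact_mod_cast k.lt_succ_self) isOpen_upperHalfPlaneSet.uniqueDiffOn z hz
  exact hd.hasDerivWithinAt.hasDerivAt (isOpen_upperHalfPlaneSet.mem_nhds hz)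

-- For `k ≥ 2`, the shift sum is a constant multiple of the `(k-1)`-st derivative of `π cot(πz)`, so
-- no separate termwise differentiation is needed.
open UpperHalfPlane Complex in
lemma hasDerivAt_intShiftSum {k : ℕ} (hk : 2 ≤ k) {z : ℂ} (hz : z ∈ upperHalfPlaneSet) :
    HasDerivAt (intShiftSum k) (-k * intShiftSum (k + 1) z) z := by
  obtain ⟨l, rfl⟩ : ∃ l, k = l + 1 := ⟨k - 1, by omega⟩
  have hl : 1 ≤ l := by omega
  have hf : (l.factorial : ℂ) ≠ 0 := by exact_mod_cast l.factorial_ne_zero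
  have h := (hasDerivAt_iteratedDerivWithin_cot l hz).const_mul ((-1) ^ l / (l.factorial : ℂ))
  have hs : ((-1 : ℂ) ^ l) * (-1) ^ l = 1 := by rw [← mul_pow]; simp
  rw [iteratedDerivWithin_cot_pi_mul_eq_mul_tsum_div_pow (by omega) hz] at h
  have h2 : ((-1) ^ l / (l.factorial : ℂ)) * ((-1) ^ (l + 1) * ((l + 1).factorial : ℂ) *
      ∑' n : ℤ, 1 / (z + n) ^ (l + 1 + 1)) = -(l + 1 : ℕ) * intShiftSum (l + 1 + 1) z := by
    rw [intShiftSum, Nat.factorial_succ]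
    push_cast
    field_simp
    linear_combination (-∑' n : ℤ, 1 / (z + n) ^ (l + 1 + 1)) * hs
  rw [h2] at h
  refine h.congr_of_eventuallyEq ?_
  filter_upwards [isOpen_upperHalfPlaneSet.mem_nhds hz] with w hw
  rw [iteratedDerivWithin_cot_pi_mul_eq_mul_tsum_div_pow hl hw, intShiftSum]
  field_simp
  linear_combination (-∑' n : ℤ, 1 / (w + n) ^ (l + 1)) * hs

open UpperHalfPlane Complex in
lemma sin_pi_mul_ne_zero_of_mem_upperHalfPlaneSet {z : ℂ} (hz : z ∈ upperHalfPlaneSet) :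
    sin (Real.pi * z) ≠ 0 :=
  sin_pi_mul_ne_zero (coe_mem_integerComplement ⟨z, hz⟩)

open UpperHalfPlane Complex in
lemma hasDerivAt_sin_pi (z : ℂ) :
    HasDerivAt (fun w : ℂ ↦ sin (Real.pi * w)) (Real.pi * cos (Real.pi * z)) z := by
  have := ((hasDerivAt_id' z).const_mul (Real.pi : ℂ)).csin
  simpa [mul_comm] using this

open UpperHalfPlane Complex in
lemma hasDerivAt_cos_pi (z : ℂ) :
    HasDerivAt (fun w : ℂ ↦ cos (Real.pi * w)) (-(Real.pi * sin (Real.pi * z))) z := by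
  have := ((hasDerivAt_id' z).const_mul (Real.pi : ℂ)).ccos
  simpa [mul_comm] using this

open UpperHalfPlane Complex in
lemma inv_sin_sq_eq_intShiftSum {z : ℂ} (hz : z ∈ upperHalfPlaneSet) :
    (Real.pi : ℂ) ^ 2 * (sin (Real.pi * z) ^ 2)⁻¹ = intShiftSum 2 z := by
  have hs := sin_pi_mul_ne_zero_of_mem_upperHalfPlaneSet hz
  have h := hasDerivAt_iteratedDerivWithin_cot 0 hz
  rw [iteratedDerivWithin_cot_pi_mul_eq_mul_tsum_div_pow (by omega) hz, iteratedDerivWithin_zero]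
    at h
  have h' := ((hasDerivAt_cos_pi z).div (hasDerivAt_sin_pi z) hs).const_mul (Real.pi : ℂ)
  have := h.unique h'
  rw [intShiftSum]
  simp only [zero_add, pow_one, Nat.factorial_one, Nat.cast_one, mul_one, Nat.reduceAdd] at this
  rw [← neg_inj, ← neg_one_mul (∑' _, _), this]
  field_simp
  linear_combination sin_sq_add_cos_sq (Real.pi * z)

open UpperHalfPlane Complex in
lemma hasDerivAt_inv_sin_pow (n : ℕ) {z : ℂ} (hz : z ∈ upperHalfPlaneSet) :
    HasDerivAt (fun w : ℂ ↦ (sin (Real.pi * w) ^ n)⁻¹)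
      (-(n * Real.pi * cos (Real.pi * z) * (sin (Real.pi * z) ^ (n + 1))⁻¹)) z := by
  have hs := sin_pi_mul_ne_zero_of_mem_upperHalfPlaneSet hz
  have h := ((hasDerivAt_sin_pi z).fun_pow n).fun_inv (pow_ne_zero n hs)
  refine h.congr_deriv ?_
  rcases n with _ | n
  · simp
  · simp only [Nat.add_sub_cancel]
    field_simp
    ring

open UpperHalfPlane Complex in
lemma hasDerivAt_cos_mul_inv_sin_pow (n : ℕ) {z : ℂ} (hz : z ∈ upperHalfPlaneSet) :
    HasDerivAt (fun w : ℂ ↦ cos (Real.pi * w) * (sin (Real.pi * w) ^ (n + 1))⁻¹)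
      (-Real.pi * ((n + 1) * (sin (Real.pi * z) ^ (n + 2))⁻¹ - n * (sin (Real.pi * z) ^ n)⁻¹))
      z := by
  have hs := sin_pi_mul_ne_zero_of_mem_upperHalfPlaneSet hz
  refine ((hasDerivAt_cos_pi z).fun_mul (hasDerivAt_inv_sin_pow (n + 1) hz)).congr_deriv ?_
  have := sin_sq_add_cos_sq (Real.pi * z)
  generalize sin (Real.pi * z) = s at *
  generalize cos (Real.pi * z) = c at *
  rw [show n + 1 + 1 = n + 2 by rfl, pow_add, pow_add, pow_one]
  push_cast
  field_simp
  linear_combination (-(n + 1) : ℂ) * this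

open UpperHalfPlane Complex in
/-- If `(sin π z)⁻²ⁿ` is a combination of shift sums, so is its logarithmic-derivative companion. -/
lemma cos_mul_inv_sin_pow_of_inv_sin_pow {n : ℕ}
    (h : ∀ z ∈ upperHalfPlaneSet, (sin (Real.pi * z) ^ (2 * n))⁻¹ =
      ∑ i ∈ Finset.Icc 1 n, sinLaurentCoeff n i / Real.pi ^ (2 * i) * intShiftSum (2 * i) z)
    {z : ℂ} (hz : z ∈ upperHalfPlaneSet) :
    n * Real.pi * (cos (Real.pi * z) * (sin (Real.pi * z) ^ (2 * n + 1))⁻¹) =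
      ∑ i ∈ Finset.Icc 1 n, i * sinLaurentCoeff n i / Real.pi ^ (2 * i) *
        intShiftSum (2 * i + 1) z := by
  have h1 := hasDerivAt_inv_sin_pow (2 * n) hz
  have h2 : HasDerivAt (fun w ↦ ∑ i ∈ Finset.Icc 1 n, sinLaurentCoeff n i / Real.pi ^ (2 * i) *
      intShiftSum (2 * i) w) _ z := HasDerivAt.fun_sum fun i hi ↦
        (hasDerivAt_intShiftSum (k := 2 * i) (by have := Finset.mem_Icc.mp hi; omega) hz).const_mul _
  have h3 := h1.unique (h2.congr_of_eventuallyEq (by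
    filter_upwards [isOpen_upperHalfPlaneSet.mem_nhds hz] with w hw using h w hw))
  have : ∀ i, sinLaurentCoeff n i / Real.pi ^ (2 * i) *
      (-(2 * i : ℕ) * intShiftSum (2 * i + 1) z) = (-2) * (i * sinLaurentCoeff n i /
        Real.pi ^ (2 * i) * intShiftSum (2 * i + 1) z) := fun i ↦ by push_cast; ring
  simp only [this, ← Finset.mul_sum] at h3
  push_cast at h3
  linear_combination (-1 / 2) * h3

open UpperHalfPlane Complex in
lemma inv_sin_pow_eq_sum_intShiftSum {n : ℕ} (hn : 1 ≤ n) :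
    ∀ z ∈ upperHalfPlaneSet, (sin (Real.pi * z) ^ (2 * n))⁻¹ =
      ∑ i ∈ Finset.Icc 1 n, sinLaurentCoeff n i / Real.pi ^ (2 * i) * intShiftSum (2 * i) z := by
  have hpi : (Real.pi : ℂ) ≠ 0 := by exact_mod_cast Real.pi_ne_zero
  induction n, hn using Nat.le_induction with
  | base =>
    intro z hz
    simp only [Finset.Icc_self, Finset.sum_singleton, sinLaurentCoeff_self, mul_one,
      ← inv_sin_sq_eq_intShiftSum hz]
    field_simp
  | succ n hn ih =>
    intro z hz
    have h1 := (hasDerivAt_cos_mul_inv_sin_pow (2 * n) hz).const_mul ((n : ℂ) * Real.pi)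
    have h2 : HasDerivAt (fun w ↦ ∑ i ∈ Finset.Icc 1 n, i * sinLaurentCoeff n i /
        Real.pi ^ (2 * i) * intShiftSum (2 * i + 1) w) _ z := HasDerivAt.fun_sum fun i hi ↦
        (hasDerivAt_intShiftSum (k := 2 * i + 1)
          (by have := Finset.mem_Icc.mp hi; omega) hz).const_mul _
    have h3 := h1.unique (h2.congr_of_eventuallyEq (by
      filter_upwards [isOpen_upperHalfPlaneSet.mem_nhds hz] with w hw using
        cos_mul_inv_sin_pow_of_inv_sin_pow ih hw))
    rw [ih z hz] at h3
    have hn0 : (n : ℂ) ≠ 0 := by exact_mod_cast (by omega : n ≠ 0)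
    have hn1 : (2 * n + 1 : ℂ) ≠ 0 := by exact_mod_cast (by omega : 2 * n + 1 ≠ 0)
    have hc : (2 * n * (2 * n + 1) : ℂ) * Real.pi ^ 2 ≠ 0 := by simp [hn0, hn1, hpi]
    apply mul_left_cancel₀ hc
    have e : ∀ i ∈ Finset.Icc 1 n, i * sinLaurentCoeff n i / Real.pi ^ (2 * i) *
        (-(2 * i + 1 : ℕ) * intShiftSum (2 * i + 1 + 1) z) = (-1 / 2) *
          ((2 * i * (2 * i + 1) : ℂ) * sinLaurentCoeff n i / Real.pi ^ (2 * i) *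
            intShiftSum (2 * (i + 1)) z) := fun i _ ↦ by
      rw [show 2 * (i + 1) = 2 * i + 1 + 1 by ring]; push_cast; ring
    rw [Finset.sum_congr rfl e, ← Finset.mul_sum] at h3
    have hrec : ∀ i, (2 * n * (2 * n + 1) : ℂ) * Real.pi ^ 2 * (sinLaurentCoeff (n + 1) (i + 1) /
        Real.pi ^ (2 * (i + 1)) * intShiftSum (2 * (i + 1)) z) =
        (2 * i * (2 * i + 1) : ℂ) * sinLaurentCoeff n i / Real.pi ^ (2 * i) *
          intShiftSum (2 * (i + 1)) z + (4 * n ^ 2) * Real.pi ^ 2 * (sinLaurentCoeff n (i + 1) /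
        Real.pi ^ (2 * (i + 1)) * intShiftSum (2 * (i + 1)) z) := fun i ↦ by
      have := sinLaurentCoeff_succ_succ hn i
      rw [show 2 * (i + 1) = 2 * i + 2 by ring, pow_add]
      field_simp
      linear_combination intShiftSum (2 * i + 2) z * this
    have reidx : ∀ (m : ℕ) (f : ℕ → ℂ), ∑ i ∈ Finset.Icc 1 m, f i =
        ∑ i ∈ Finset.range m, f (i + 1) := fun m f ↦ by
      rw [Finset.range_eq_Ico, Finset.sum_Ico_add' f 0 m 1]
      rfl
    -- The index ranges match because `c_{n,n+1} = 0` kills the top term of one sum and the factor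
    -- `2i` kills the `i = 0` term of the other.
    have hz0 : sinLaurentCoeff n (n + 1) = 0 := sinLaurentCoeff_eq_zero n.lt_succ_self
    rw [reidx, Finset.mul_sum, Finset.sum_congr rfl fun i _ ↦ hrec i, Finset.sum_add_distrib,
      ← Finset.mul_sum, Finset.sum_range_succ' _ n, Finset.sum_range_succ _ n, hz0]
    rw [reidx, reidx] at h3
    push_cast at h3 ⊢
    rw [show 2 * (n + 1) = 2 * n + 2 by ring]
    linear_combination (-2) * h3

/-! ### Passage to real non-integral points. -/

lemma summable_one_div_add_int_pow {k : ℕ} (hk : 2 ≤ k) (z : ℂ) :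
    Summable fun m : ℤ ↦ 1 / (z + m) ^ k := by
  simpa [zpow_natCast] using
    EisensteinSeries.linear_right_summable z 1 (k := (k : ℤ)) (by exact_mod_cast hk)

-- Dominated convergence along the vertical line: `|x + iy + m| ≥ |x + m|`, so the series at `x`
-- itself is the majorant.
open Complex Filter Topology in
lemma tendsto_intShiftSum {k : ℕ} (hk : 2 ≤ k) {x : ℝ} (hx : ∀ m : ℤ, (x : ℂ) + m ≠ 0) :
    Tendsto (fun y : ℝ ↦ intShiftSum k (x + y * I)) (𝓝[>] 0) (𝓝 (intShiftSum k x)) := by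
  refine tendsto_tsum_of_dominated_convergence (summable_one_div_add_int_pow hk (x : ℂ)).norm ?_ ?_
  · intro m
    have : ContinuousAt (fun y : ℝ ↦ 1 / ((x : ℂ) + y * I + m) ^ k) 0 :=
      ContinuousAt.div (by fun_prop) (by fun_prop) (pow_ne_zero _ (by simpa using hx m))
    simpa using this.tendsto.mono_left nhdsWithin_le_nhds
  · refine Eventually.of_forall fun y m ↦ ?_
    rw [norm_div, norm_div, norm_pow, norm_pow]
    have h0 : 0 < ‖(x : ℂ) + m‖ := norm_pos_iff.mpr (hx m)
    gcongr
    have := abs_re_le_norm ((x : ℂ) + y * I + m)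
    simp only [add_re, ofReal_re, mul_re, I_re, mul_zero, ofReal_im, I_im, zero_mul, sub_zero,
      add_zero, intCast_re] at this
    rw [show (x : ℂ) + m = ((x + m : ℝ) : ℂ) by push_cast; rfl, norm_real]
    exact this

open Complex Filter Topology in
/-- An identity between a function continuous at a real point and a combination of shift sums
extends from the upper half plane to that point. -/
lemma eq_sum_intShiftSum_of_upperHalfPlane {f : ℂ → ℂ} {s : Finset ℕ} {a : ℕ → ℂ} {e : ℕ → ℕ}
    (he : ∀ i ∈ s, 2 ≤ e i) {x : ℝ} (hx : ∀ m : ℤ, (x : ℂ) + m ≠ 0) (hf : ContinuousAt f x)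
    (h : ∀ z ∈ UpperHalfPlane.upperHalfPlaneSet, f z = ∑ i ∈ s, a i * intShiftSum (e i) z) :
    f x = ∑ i ∈ s, a i * intShiftSum (e i) x := by
  have h1 : Tendsto (fun y : ℝ ↦ f (x + y * I)) (𝓝[>] 0) (𝓝 (f x)) := by
    have hc : Tendsto (fun y : ℝ ↦ (x : ℂ) + y * I) (𝓝 0) (𝓝 x) :=
      (by fun_prop : Continuous fun y : ℝ ↦ (x : ℂ) + y * I).tendsto' 0 _ (by simp)
    exact hf.tendsto.comp (hc.mono_left nhdsWithin_le_nhds)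
  have h2 : Tendsto (fun y : ℝ ↦ ∑ i ∈ s, a i * intShiftSum (e i) (x + y * I)) (𝓝[>] 0)
      (𝓝 (∑ i ∈ s, a i * intShiftSum (e i) x)) :=
    tendsto_finsetSum _ fun i hi ↦ (tendsto_intShiftSum (he i hi) hx).const_mul _
  refine tendsto_nhds_unique (h1.congr' ?_) h2
  filter_upwards [self_mem_nhdsWithin] with y hy
  exact h _ (by simpa [UpperHalfPlane.upperHalfPlaneSet] using hy)

/-! ### Gauss sums and character sums over the integers. -/

lemma sum_Icc_natCast_zmod {N : ℕ} [NeZero N] (f : ZMod N → ℂ) :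
    ∑ j ∈ Finset.Icc 1 N, f (j : ZMod N) = ∑ a, f a := by
  have h1 : ∑ j ∈ Finset.Icc 1 N, f (j : ZMod N) = ∑ j ∈ Finset.range N, f (j : ZMod N) := by
    rw [show Finset.Icc 1 N = Finset.Ico (0 + 1) (N + 1) by rfl, ← Finset.sum_Ico_add',
      ← Finset.range_eq_Ico]
    have h := Finset.sum_range_succ (fun j : ℕ ↦ f (j : ZMod N)) N
    rw [Finset.sum_range_succ'] at h
    simpa using h
  rw [h1]
  obtain ⟨n, rfl⟩ := Nat.exists_eq_succ_of_ne_zero (NeZero.ne N)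
  rw [← Fin.sum_univ_eq_sum_range (fun j : ℕ ↦ f (j : ZMod (n + 1)))]
  exact Finset.sum_congr rfl fun i _ ↦ congrArg f (Fin.cast_val_eq_self i)

lemma star_isPrimitive {N : ℕ} {χ : DirichletCharacter ℂ N} (hχ : χ.IsPrimitive) :
    (star χ).IsPrimitive := by
  rw [MulChar.star_eq_inv, DirichletCharacter.isPrimitive_def, DirichletCharacter.conductor_inv]
  exact hχ

lemma dirichletGaussSum_eq_gaussSum {N : ℕ} [NeZero N] (χ : DirichletCharacter ℂ N) :
    dirichletGaussSum N χ = gaussSum χ ZMod.stdAddChar := by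
  rw [dirichletGaussSum, gaussSum, ← sum_Icc_natCast_zmod]
  refine Finset.sum_congr rfl fun j _ ↦ ?_
  have := ZMod.stdAddChar_coe (N := N) (j : ℤ)
  push_cast at this
  rw [this]

/-- The discrete Fourier transform of a primitive `χ` is a multiple of this Gauss sum, and it is
injective while `χ(1) = 1`. -/
lemma gaussSum_stdAddChar_ne_zero {N : ℕ} [NeZero N] {χ : DirichletCharacter ℂ N}
    (hχ : χ.IsPrimitive) : gaussSum χ ZMod.stdAddChar ≠ 0 := fun h ↦ by
  have h0 : ZMod.dft (χ : ZMod N → ℂ) = 0 := by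
    ext k
    rw [hχ.fourierTransform_eq_inv_mul_gaussSum, h]
    simp
  have h1 := congrFun ((LinearEquiv.map_eq_zero_iff _).mp h0) 1
  simp at h1

lemma mul_dirichletGaussSum_star {N : ℕ} [NeZero N] {χ : DirichletCharacter ℂ N}
    (hχ : χ.IsPrimitive) (l : ℤ) :
    χ (l : ZMod N) * dirichletGaussSum N (star χ) =
      ∑ j ∈ Finset.Icc 1 N, starRingEnd ℂ (χ (j : ZMod N)) *
        fourier l (((j : ℝ) / (N : ℝ) : ℝ) : UnitAddCircle) := by
  have h := gaussSum_mulShift_of_isPrimitive ZMod.stdAddChar (star_isPrimitive hχ) (l : ZMod N)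
  rw [← MulChar.star_eq_inv, star_star] at h
  rw [dirichletGaussSum_eq_gaussSum, ← h, gaussSum, ← sum_Icc_natCast_zmod]
  refine Finset.sum_congr rfl fun j _ ↦ ?_
  rw [MulChar.star_apply, AddChar.mulShift_apply, fourier_coe_apply]
  have := ZMod.stdAddChar_coe (N := N) (l * j : ℤ)
  push_cast at this
  rw [this]
  simp only [RCLike.star_def]
  congr 2
  push_cast
  ring

-- Fourier expansion of the Bernoulli functions at `j/N`, weighted by `χ̄(j)/G(χ̄)`. The `l = 0`
-- term is zero by the convention `1/0 = 0`.
open Complex in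
lemma hasSum_primitive_div_int_pow {N : ℕ} [NeZero N] {χ : DirichletCharacter ℂ N}
    (hχ : χ.IsPrimitive) {k : ℕ} (hk : 2 ≤ k) :
    HasSum (fun l : ℤ ↦ χ (l : ZMod N) / (l : ℂ) ^ k)
      (∑ j ∈ Finset.Icc 1 N, (starRingEnd ℂ (χ (j : ZMod N)) / dirichletGaussSum N (star χ)) *
        (-(2 * Real.pi * I) ^ k / k.factorial * bernoulliFun k ((j : ℝ) / (N : ℝ)))) := by
  have hG : dirichletGaussSum N (star χ) ≠ 0 := by
    rw [dirichletGaussSum_eq_gaussSum]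
    exact gaussSum_stdAddChar_ne_zero (star_isPrimitive hχ)
  have h := hasSum_sum (s := Finset.Icc 1 N) fun j hj ↦
    (hasSum_one_div_pow_mul_fourier_mul_bernoulliFun hk (x := (j : ℝ) / (N : ℝ)) (by
      have hN : (0 : ℝ) < N := by exact_mod_cast NeZero.pos N
      have : (j : ℝ) ≤ N := by exact_mod_cast (Finset.mem_Icc.mp hj).2
      exact ⟨by positivity, (div_le_one hN).mpr this⟩)).mul_left
        (starRingEnd ℂ (χ (j : ZMod N)) / dirichletGaussSum N (star χ))
  refine h.congr_fun fun l ↦ ?_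
  rw [← mul_div_cancel_right₀ (χ (l : ZMod N)) hG, mul_dirichletGaussSum_star hχ, Finset.sum_div,
    Finset.sum_div]
  refine Finset.sum_congr rfl fun j _ ↦ ?_
  ring

/-- Division with remainder, `l = qN + b = N(b/N + q)`, splits the sum over `l` into residue
classes; the class `b = 0` drops out since `χ(0) = 0`. -/
lemma sum_mul_intShiftSum_div {N : ℕ} [NeZero N] (hN : 1 < N) (χ : DirichletCharacter ℂ N) {k : ℕ}
    (hk : 2 ≤ k) {a : ℂ} (h : HasSum (fun l : ℤ ↦ χ (l : ZMod N) / (l : ℂ) ^ k) a) :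
    ∑ m ∈ Finset.Icc 1 (N - 1), χ (m : ZMod N) * intShiftSum k (m / N) = (N : ℂ) ^ k * a := by
  have hN0 : (N : ℂ) ≠ 0 := by exact_mod_cast NeZero.ne N
  have h1 := (Equiv.hasSum_iff ((Equiv.prodComm _ _).trans (Int.divModEquiv N).symm)).mpr h
  have h2 : ∀ b : Fin N, HasSum (fun q : ℤ ↦ ((fun l : ℤ ↦ χ (l : ZMod N) / (l : ℂ) ^ k) ∘
      ((Equiv.prodComm _ _).trans (Int.divModEquiv N).symm)) (b, q))
      (χ ((b : ℕ) : ZMod N) / (N : ℂ) ^ k * intShiftSum k ((b : ℕ) / N)) := fun b ↦ by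
    refine ((summable_one_div_add_int_pow hk ((b : ℕ) / N : ℂ)).hasSum.mul_left _).congr_fun
      fun q ↦ ?_
    have : (q : ℂ) * N + (b : ℕ) = N * ((b : ℕ) / N + q) := by field_simp; ring
    simp only [Function.comp_apply, Equiv.trans_apply, Equiv.prodComm_apply, Prod.swap_prod_mk,
      Int.divModEquiv_symm_apply]
    push_cast
    rw [this, mul_pow, ZMod.natCast_self, mul_zero, zero_add]
    ring
  have h3 := (h1.prod_fiberwise h2).unique (hasSum_fintype _)
  rw [h3, Fin.sum_univ_eq_sum_range (fun b : ℕ ↦ χ (b : ZMod N) / (N : ℂ) ^ k *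
    intShiftSum k (b / N)) N, Finset.mul_sum]
  obtain ⟨n, rfl⟩ : ∃ n, N = n + 1 := ⟨N - 1, by omega⟩
  have h0 : χ ((0 : ℕ) : ZMod (n + 1)) = 0 := by
    have : Nontrivial (ZMod (n + 1)) := ZMod.nontrivial_iff.mpr (by omega)
    simpa using χ.map_nonunit not_isUnit_zero
  rw [Finset.sum_range_succ', h0, zero_div, zero_mul, mul_zero, add_zero, Nat.add_sub_cancel,
    show Finset.Icc 1 n = Finset.Ico (0 + 1) (n + 1) by rfl, ← Finset.sum_Ico_add',
    ← Finset.range_eq_Ico]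
  refine Finset.sum_congr rfl fun b _ ↦ ?_
  field_simp

/-! ### Evaluation at `m/N` and conclusion. -/

lemma natCast_div_add_intCast_ne_zero {N m : ℕ} (hm : m ∈ Finset.Icc 1 (N - 1)) (l : ℤ) :
    (((m : ℝ) / (N : ℝ) : ℝ) : ℂ) + l ≠ 0 := by
  obtain ⟨h1, h2⟩ := Finset.mem_Icc.mp hm
  have hN : (N : ℝ) ≠ 0 := by exact_mod_cast (by omega : N ≠ 0)
  intro h
  have h3 : (m : ℝ) / N + l = 0 := by exact_mod_cast h
  have h4 : (m : ℝ) + l * N = 0 := by field_simp at h3; linarith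
  have h5 : (m : ℤ) + l * N = 0 := by exact_mod_cast h4
  have h6 : (N : ℤ) ∣ m := ⟨-l, by linarith⟩
  have := Nat.le_of_dvd (by omega) (Int.natCast_dvd_natCast.mp h6)
  omega

lemma sin_pi_mul_div_ne_zero {N m : ℕ} (hm : m ∈ Finset.Icc 1 (N - 1)) :
    Complex.sin (Real.pi * (((m : ℝ) / (N : ℝ) : ℝ) : ℂ)) ≠ 0 := by
  refine sin_pi_mul_ne_zero ?_
  rintro ⟨l, hl⟩
  refine natCast_div_add_intCast_ne_zero hm (-l) ?_
  rw [← hl]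
  simp

open Complex in
lemma inv_sin_pow_div_eq_sum {N m n : ℕ} (hn : 1 ≤ n) (hm : m ∈ Finset.Icc 1 (N - 1)) :
    (((Real.sin (m * Real.pi / N) : ℝ) : ℂ) ^ (2 * n))⁻¹ =
      ∑ i ∈ Finset.Icc 1 n, sinLaurentCoeff n i / Real.pi ^ (2 * i) *
        intShiftSum (2 * i) (m / N) := by
  have hs := sin_pi_mul_div_ne_zero hm
  have h := eq_sum_intShiftSum_of_upperHalfPlane (s := Finset.Icc 1 n)
    (f := fun z ↦ (sin (Real.pi * z) ^ (2 * n))⁻¹) (e := fun i ↦ 2 * i)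
    (fun i hi ↦ by have := Finset.mem_Icc.mp hi; omega) (natCast_div_add_intCast_ne_zero hm)
    (ContinuousAt.inv₀ (by fun_prop) (pow_ne_zero _ hs)) (inv_sin_pow_eq_sum_intShiftSum hn)
  push_cast at h ⊢
  rw [← h, mul_div_assoc', mul_comm (Real.pi : ℂ)]

open Complex in
lemma cot_mul_inv_sin_pow_div_eq_sum {N m n : ℕ} (hn : 1 ≤ n) (hm : m ∈ Finset.Icc 1 (N - 1)) :
    ((Real.cot (m * Real.pi / N) : ℝ) : ℂ) * (((Real.sin (m * Real.pi / N) : ℝ) : ℂ) ^ (2 * n))⁻¹ =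
      1 / n * ∑ i ∈ Finset.Icc 1 n, i * sinLaurentCoeff n i / Real.pi ^ (2 * i + 1) *
        intShiftSum (2 * i + 1) (m / N) := by
  have hs := sin_pi_mul_div_ne_zero hm
  have hpi : (Real.pi : ℂ) ≠ 0 := by exact_mod_cast Real.pi_ne_zero
  have hn0 : (n : ℂ) ≠ 0 := by exact_mod_cast (by omega : n ≠ 0)
  have h := eq_sum_intShiftSum_of_upperHalfPlane (s := Finset.Icc 1 n)
    (f := fun z ↦ n * Real.pi * (cos (Real.pi * z) * (sin (Real.pi * z) ^ (2 * n + 1))⁻¹))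
    (e := fun i ↦ 2 * i + 1)
    (fun i hi ↦ by have := Finset.mem_Icc.mp hi; omega) (natCast_div_add_intCast_ne_zero hm)
    (ContinuousAt.mul (by fun_prop) (ContinuousAt.mul (by fun_prop)
      (ContinuousAt.inv₀ (by fun_prop) (pow_ne_zero _ hs))))
    (fun z hz ↦ cos_mul_inv_sin_pow_of_inv_sin_pow (inv_sin_pow_eq_sum_intShiftSum hn) hz)
  have h1 : ∀ i, i * sinLaurentCoeff n i / Real.pi ^ (2 * i + 1) *
      intShiftSum (2 * i + 1) (m / N) = (Real.pi : ℂ)⁻¹ * (i * sinLaurentCoeff n i /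
        Real.pi ^ (2 * i) * intShiftSum (2 * i + 1) (m / N)) := fun i ↦ by
    rw [pow_succ]; field_simp
  rw [Finset.sum_congr rfl fun i _ ↦ h1 i, ← Finset.mul_sum]
  push_cast at h hs ⊢
  rw [← h, mul_comm (m : ℂ) (Real.pi : ℂ), ← mul_div_assoc', Complex.cot_eq_cos_div_sin, pow_succ]
  field_simp

lemma ofReal_sin_cpow_two_mul_natCast (x : ℝ) (n : ℕ) :
    ((Real.sin x : ℝ) : ℂ) ^ (2 * (n : ℂ)) = ((Real.sin x : ℝ) : ℂ) ^ (2 * n) := by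
  rw [← Complex.cpow_natCast]
  push_cast
  rfl

open Complex in
/-- Summing shift sums against a primitive character gives Bernoulli values. -/
lemma sum_primitive_mul_sum_intShiftSum {N : ℕ} (hN : 1 < N) {χ : DirichletCharacter ℂ N}
    (hχ : χ.IsPrimitive) {s : Finset ℕ} (a : ℕ → ℂ) {e : ℕ → ℕ} (he : ∀ i ∈ s, 2 ≤ e i) :
    ∑ m ∈ Finset.Icc 1 (N - 1), χ (m : ZMod N) *
        ∑ i ∈ s, a i / Real.pi ^ e i * intShiftSum (e i) (m / N) =
      -∑ j ∈ Finset.Icc 1 N,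
        (starRingEnd ℂ (χ (j : ZMod N)) / dirichletGaussSum N (star χ)) *
          ∑ i ∈ s, ((2 * I) ^ e i * ((bernoulliFun (e i) ((j : ℝ) / (N : ℝ)) : ℝ) : ℂ) /
            ((e i).factorial : ℂ)) * a i * (N : ℂ) ^ e i := by
  have : NeZero N := ⟨by omega⟩
  have hpi : (Real.pi : ℂ) ≠ 0 := by exact_mod_cast Real.pi_ne_zero
  simp only [Finset.mul_sum]
  rw [Finset.sum_comm, Finset.sum_comm (s := Finset.Icc 1 N), ← Finset.sum_neg_distrib]
  refine Finset.sum_congr rfl fun i hi ↦ ?_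
  have h := sum_mul_intShiftSum_div hN χ (he i hi) (hasSum_primitive_div_int_pow hχ (he i hi))
  have h1 : ∀ m : ℕ, χ (m : ZMod N) * (a i / Real.pi ^ e i * intShiftSum (e i) (m / N)) =
      a i / Real.pi ^ e i * (χ (m : ZMod N) * intShiftSum (e i) (m / N)) := fun m ↦ by ring
  rw [Finset.sum_congr rfl fun m _ ↦ h1 m, ← Finset.mul_sum, h, Finset.mul_sum, Finset.mul_sum,
    ← Finset.sum_neg_distrib]
  refine Finset.sum_congr rfl fun j _ ↦ ?_
  rw [show 2 * (Real.pi : ℂ) * I = Real.pi * (2 * I) by ring, mul_pow (Real.pi : ℂ)]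
  field_simp

theorem corollary3p6 (N : ℕ) (hN : 1 < N) (χ : DirichletCharacter ℂ N)
    (hχ : χ.IsPrimitive) (n : ℕ) (hn : 1 ≤ n) :
    (χ.Even →
      cycleGraphL N n χ =
        ∑ j ∈ Finset.Icc 1 N,
          (starRingEnd ℂ (χ (j : ZMod N)) / dirichletGaussSum N (star χ)) *
            ∑ i ∈ Finset.Icc 1 n,
              ((-1 : ℂ) ^ (i - 1) * 2 ^ (2 * i) *
                  ((bernoulliFun (2 * i) ((j : ℝ) / (N : ℝ)) : ℝ) : ℂ) /
                  ((2 * i).factorial : ℂ)) *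
                sinLaurentCoeff n i * (N : ℂ) ^ (2 * i)) ∧
    (χ.Odd →
      cycleGraphLTilde N n χ =
        -(1 / (n : ℂ)) * ∑ j ∈ Finset.Icc 1 N,
          (starRingEnd ℂ (χ (j : ZMod N)) / dirichletGaussSum N (star χ)) *
            ∑ i ∈ Finset.Icc 1 n,
              ((2 * Complex.I) ^ (2 * i + 1) *
                  ((bernoulliFun (2 * i + 1) ((j : ℝ) / (N : ℝ)) : ℝ) : ℂ) /
                  ((2 * i + 1).factorial : ℂ)) *
                ((i : ℂ) * sinLaurentCoeff n i) * (N : ℂ) ^ (2 * i + 1)) := by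
  have hval := fun (a : ℕ → ℂ) (e : ℕ → ℕ) (he : ∀ i ∈ Finset.Icc 1 n, 2 ≤ e i) ↦
    sum_primitive_mul_sum_intShiftSum hN hχ a he
  refine ⟨fun _ ↦ ?_, fun _ ↦ ?_⟩
  · have h := hval (sinLaurentCoeff n) (fun i ↦ 2 * i)
      fun i hi ↦ by have := Finset.mem_Icc.mp hi; omega
    have h1 : cycleGraphL N n χ = ∑ m ∈ Finset.Icc 1 (N - 1), χ (m : ZMod N) *
        ∑ i ∈ Finset.Icc 1 n, sinLaurentCoeff n i / Real.pi ^ (2 * i) *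
          intShiftSum (2 * i) (m / N) := Finset.sum_congr rfl fun m hm ↦ by
      rw [ofReal_sin_cpow_two_mul_natCast, div_eq_mul_inv, inv_sin_pow_div_eq_sum hn hm]
    rw [h1, h, ← Finset.sum_neg_distrib]
    refine Finset.sum_congr rfl fun j _ ↦ ?_
    rw [← mul_neg, ← Finset.sum_neg_distrib]
    congr 1
    refine Finset.sum_congr rfl fun i hi ↦ ?_
    -- `(2√-1)^{2i} = (-1)^i 2^{2i}`, and the outer minus sign turns `(-1)^i` into `(-1)^{i-1}`.
    obtain ⟨k, rfl⟩ : ∃ k, i = k + 1 := ⟨i - 1, by have := Finset.mem_Icc.mp hi; omega⟩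
    rw [mul_pow, pow_mul Complex.I, Complex.I_sq, Nat.add_sub_cancel, pow_succ (-1 : ℂ)]
    ring
  · have h := hval (fun i ↦ i * sinLaurentCoeff n i) (fun i ↦ 2 * i + 1)
      fun i hi ↦ by have := Finset.mem_Icc.mp hi; omega
    have h1 : cycleGraphLTilde N n χ = 1 / n * ∑ m ∈ Finset.Icc 1 (N - 1), χ (m : ZMod N) *
        ∑ i ∈ Finset.Icc 1 n, i * sinLaurentCoeff n i / Real.pi ^ (2 * i + 1) *
          intShiftSum (2 * i + 1) (m / N) := by
      rw [Finset.mul_sum]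
      refine Finset.sum_congr rfl fun m hm ↦ ?_
      rw [ofReal_sin_cpow_two_mul_natCast, div_eq_mul_inv, mul_assoc,
        cot_mul_inv_sin_pow_div_eq_sum hn hm]
      ring
    rw [h1, h]
    ring
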